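/- Let $0 < a \le b$ and let $(x_{ij})_{i,j \ge 1}$ be independent identically distributed $N(0,1)$ random variables. For integers $n \ge m$, let $\mathbf{M}(n,m,[a,b])$ be the set of $n \times m$ real matrices with all entries in $[a,b]$. For such a matrix $A = (a_{ij})$ put $X(A) = (\sqrt{a_{ij}}\, x_{ij})_{1 \le i \le n,\, 1 \le j \le m}$ and $Z(A) = X(A)^T X(A)$, and define the permanent of $A$ by $$\operatorname{per} A = \sum_{1 \le \alpha_1 < \dots < \alpha_m \le n} \operatorname{per}\,(a_{\alpha_i j})_{i,j=1}^m ,$$ where $\operatorname{per} B = \sum_{\sigma} b_{1\sigma(1)} \cdots b_{m\sigma(m)}$, summed over all permutations $\sigma$ of $\{1,\dots,m\}$, for a square matrix $B = (b_{ij})_{i,j=1}^m$. Then for every $\delta > 0$, $$\lim_{n \to \infty} \ \sup_{m \le n}\ \sup_{A \in \mathbf{M}(n,m,[a,b])} \mathbb{P}\left( \frac1n \left| \log \det Z(A) - \log \operatorname{per} A \right| > \delta \right) = 0 ,$$ where $\log 0 = -\infty$. -/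

import Mathlib

open MeasureTheory ProbabilityTheory Filter Topology

noncomputable section

namespace PermanentEstimator

/-- The permanent of an `n × m` matrix: the sum, over all strictly increasing
sequences `α` of `m` row indices, of the permanents of the square submatrices
formed by the rows `α 0 < α 1 < ⋯` and all `m` columns. -/
def rectPermanent {n m : ℕ} (A : Matrix (Fin n) (Fin m) ℝ) : ℝ :=
  ∑ α : Fin m ↪o Fin n, (A.submatrix α id).permanent

/-- `X(A) = (√a_ij x_ij)`, for a realization `x` of the infinite array. -/
def weightedMatrix {n m : ℕ} (A : Matrix (Fin n) (Fin m) ℝ) (x : ℕ → ℕ → ℝ) :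
    Matrix (Fin n) (Fin m) ℝ :=
  Matrix.of fun i j => √(A i j) * x i j

/-- `Z(A) = X(A)ᵀ X(A)`. -/
def gramMatrix {n m : ℕ} (A : Matrix (Fin n) (Fin m) ℝ) (x : ℕ → ℕ → ℝ) :
    Matrix (Fin m) (Fin m) ℝ :=
  (weightedMatrix A x).transpose * weightedMatrix A x

/-- The event that `n⁻¹ |log det Z(A) - log per A| > δ`, where `log 0 = -∞`:
since `Real.log 0 = 0`, the outcomes with `det Z(A) = 0` are added explicitly. -/
def deviationEvent {Ω : Type*} {n m : ℕ} (x : ℕ → ℕ → Ω → ℝ)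
    (A : Matrix (Fin n) (Fin m) ℝ) (δ : ℝ) : Set Ω :=
  {ω | (gramMatrix A fun i j => x i j ω).det = 0 ∨
    δ < 1 / (n : ℝ) *
      |Real.log (gramMatrix A fun i j => x i j ω).det - Real.log (rectPermanent A)|}

end PermanentEstimator

end

/-!
Write `D = det Z(A)`. By the Cauchy–Binet formula `D` is the sum of the squares of the `m × m`
minors of `X(A)`; each minor is an alternating form in the columns, and `E D = per A`
(`energy_minorForm`, `lintegral_det_gramMatrix`). The upper tail is therefore Markov's inequality
for `D`. The lower tail is Markov's inequality for `D ^ (-1/8)`, once the negative moment is known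
to satisfy `E D ^ (-1/8) ≤ exp (O(√m)) (per A) ^ (-1/8)`
(`lintegral_sum_sq_scale_rpow_neg_le`, `exists_prod_columnFactor_le`): since `√m ≤ √n = o(n)`,
this loses nothing on the exponential scale. Working with a negative power in `ℝ≥0∞` also covers
the event `D = 0`, where `0 ^ (-1/8) = ∞`.

The negative moment is estimated one column at a time. With some columns fixed and the remaining
`r` averaged out, the conditional mean of `D` is a positive quadratic form `q` in the next column
`X`, and it has to be shown that `E q(X) ^ (-1/8) ≤ (1 + O(1/√(r + 1))) (E q(X)) ^ (-1/8)`.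

* Such a bound follows for a Gaussian quadratic form once its variance is
  `O((E q(X))² / (r + 1))`: use `R ^ (-s) ≤ 1 + R ^ (-s) |1 - R|` for `R = q(X) / E q(X)`, the
  Cauchy–Schwarz inequality, and Jensen's inequality to bound `E R ^ (-2s)` by a moment of one
  Gaussian variable (`lintegral_rpow_neg_le_of_sum_sq_le`).
* The variance is small because `q` has no dominant direction: `(r + 1) q(u) ≤ (2b/a) tr q` for
  every unit vector `u` (`energy_contract_le`). Indeed, every remaining column has covariance at
  least `a u uᵀ`; replacing the covariance of one remaining column by `a u uᵀ`, for each of the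
  `r` columns in turn, gives pieces whose sum is still bounded by the whole, because pieces with
  `u` inserted twice vanish by alternation (`mul_sum_energy_contract_le`). Each piece, summed over
  an orthonormal basis in the place of `X`, is at least `(a/b) q(u)`, as the freed argument can
  play the part of the column that was replaced.
-/

noncomputable section

namespace PermanentEstimator

open Finset
open scoped ENNReal NNReal

/-! ### The energy of a family of alternating forms -/

section

variable {ι : Type*} [Fintype ι] {n r : ℕ}

/-- The second moment of the family `Φ` at independent centred vectors `X₀, …, X_{r-1}`, where
`X_l` has independent coordinates of variances `w l i`: the expectation of `∑ k, Φ k (X) ^ 2`,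
expanded by multilinearity over the standard basis (see `lintegral_sum_sq_scale`). -/
def energy (w : Fin r → Fin n → ℝ) (Φ : ι → (Fin n → ℝ) [⋀^Fin r]→ₗ[ℝ] ℝ) : ℝ :=
  ∑ f : Fin r → Fin n, (∏ l, w l (f l)) * ∑ k, (Φ k fun l => Pi.single (f l) 1) ^ 2

/-- The forms `Φ k (x, ·, …, ·)` obtained by fixing the first argument. -/
def contract (Φ : ι → (Fin n → ℝ) [⋀^Fin (r + 1)]→ₗ[ℝ] ℝ) (x : Fin n → ℝ) :
    ι → (Fin n → ℝ) [⋀^Fin r]→ₗ[ℝ] ℝ :=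
  fun k => (Φ k).curryLeft x

lemma energy_nonneg {w : Fin r → Fin n → ℝ} (hw : ∀ l i, 0 ≤ w l i)
    (Φ : ι → (Fin n → ℝ) [⋀^Fin r]→ₗ[ℝ] ℝ) : 0 ≤ energy w Φ :=
  sum_nonneg fun _ _ => mul_nonneg (prod_nonneg fun _ _ => hw _ _)
    (sum_nonneg fun _ _ => sq_nonneg _)

/-- Expansion of the energy along the `l`-th argument; by alternation that argument may be moved
to the front, the sign being lost in the squares. -/
lemma energy_succAbove (w : Fin (r + 1) → Fin n → ℝ)
    (Φ : ι → (Fin n → ℝ) [⋀^Fin (r + 1)]→ₗ[ℝ] ℝ) (l : Fin (r + 1)) :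
    energy w Φ = ∑ i, w l i * energy (fun j => w (l.succAbove j)) (contract Φ (Pi.single i 1)) := by
  unfold energy
  rw [← (Fin.insertNthEquiv (fun _ : Fin (r + 1) => Fin n) l).sum_comp, Fintype.sum_prod_type]
  refine sum_congr rfl fun i _ => ?_
  rw [mul_sum]
  refine sum_congr rfl fun f _ => ?_
  have h : (fun j => (Pi.single (l.insertNth (α := fun _ => Fin n) i f j) 1 : Fin n → ℝ)) =
      l.insertNth (α := fun _ => Fin n → ℝ) (Pi.single i 1) (fun j => Pi.single (f j) 1) := by
    rw [Fin.eq_insertNth_iff]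
    constructor
    · simp
    · ext j : 1
      simp [Fin.removeNth]
  simp only [Fin.insertNthEquiv_apply, h, Fin.prod_univ_succAbove _ l, Fin.insertNth_apply_same,
    Fin.insertNth_apply_succAbove, contract, AlternatingMap.curryLeft_apply_apply,
    AlternatingMap.map_insertNth, mul_assoc]
  refine congrArg _ (congrArg _ (sum_congr rfl fun k _ => ?_))
  rw [smul_pow]
  simp [← pow_mul, mul_comm _ 2]

lemma energy_succ (w : Fin (r + 1) → Fin n → ℝ)
    (Φ : ι → (Fin n → ℝ) [⋀^Fin (r + 1)]→ₗ[ℝ] ℝ) :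
    energy w Φ = ∑ i, w 0 i * energy (fun j => w j.succ) (contract Φ (Pi.single i 1)) := by
  simpa using energy_succAbove w Φ 0

lemma energy_contract_comm (w : Fin r → Fin n → ℝ)
    (Φ : ι → (Fin n → ℝ) [⋀^Fin (r + 2)]→ₗ[ℝ] ℝ) (x y : Fin n → ℝ) :
    energy w (contract (contract Φ x) y) = energy w (contract (contract Φ y) x) := by
  unfold energy
  refine sum_congr rfl fun f _ => congrArg _ (sum_congr rfl fun k _ => ?_)
  simp only [contract, AlternatingMap.curryLeft_apply_apply]
  have := (Φ k).map_swap (Matrix.vecCons x (Matrix.vecCons y fun l => Pi.single (f l) 1))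
    (i := 0) (j := 1) (by simp)
  rw [← neg_sq, ← this]
  congr 2
  ext j : 1
  refine Fin.cases ?_ (fun j => Fin.cases ?_ (fun j => ?_) j) j
  · simp
  · simp
  · rw [Function.comp_apply, Equiv.swap_apply_of_ne_of_ne] <;> simp [Fin.ext_iff]

lemma energy_contract_self (w : Fin r → Fin n → ℝ)
    (Φ : ι → (Fin n → ℝ) [⋀^Fin (r + 2)]→ₗ[ℝ] ℝ) (x : Fin n → ℝ) :
    energy w (contract (contract Φ x) x) = 0 := by
  simp [energy, contract]


/-- The linear forms in `x` whose squares add up to `energy w (contract Φ x)`: one for each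
choice of basis vectors in the remaining arguments and each member of the family. -/
def contractMatrix (w : Fin r → Fin n → ℝ) (Φ : ι → (Fin n → ℝ) [⋀^Fin (r + 1)]→ₗ[ℝ] ℝ) :
    Matrix ((Fin r → Fin n) × ι) (Fin n) ℝ :=
  fun p i => √(∏ l, w l (p.1 l)) * contract Φ (Pi.single i 1) p.2 fun l => Pi.single (p.1 l) 1

lemma energy_contract {w : Fin r → Fin n → ℝ} (hw : ∀ l i, 0 ≤ w l i)
    (Φ : ι → (Fin n → ℝ) [⋀^Fin (r + 1)]→ₗ[ℝ] ℝ) (x : Fin n → ℝ) :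
    energy w (contract Φ x) = ∑ p, (contractMatrix w Φ p ⬝ᵥ x) ^ 2 := by
  unfold energy
  rw [Fintype.sum_prod_type]
  refine sum_congr rfl fun f _ => ?_
  rw [mul_sum]
  refine sum_congr rfl fun k _ => ?_
  have h : contractMatrix w Φ (f, k) ⬝ᵥ x =
      √(∏ l, w l (f l)) * contract Φ x k fun l => Pi.single (f l) 1 := by
    let L : (Fin n → ℝ) →ₗ[ℝ] ℝ :=
      { toFun := fun x => contract Φ x k fun l => Pi.single (f l) 1
        map_add' := fun x y => by simp [contract]
        map_smul' := fun c x => by simp [contract] }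
    change _ = √(∏ l, w l (f l)) * L x
    rw [L.pi_apply_eq_sum_univ x, mul_sum]
    refine sum_congr rfl fun i _ => ?_
    have hi : (fun j => if i = j then (1 : ℝ) else 0) = Pi.single i 1 := by
      ext j
      simp [Pi.single_apply, eq_comm]
    rw [hi, smul_eq_mul]
    change √(∏ l, w l (f l)) * (contract Φ (Pi.single i 1) k fun l => Pi.single (f l) 1) * x i =
      √(∏ l, w l (f l)) * (x i * contract Φ (Pi.single i 1) k fun l => Pi.single (f l) 1)
    ring
  rw [h, mul_pow, Real.sq_sqrt (prod_nonneg fun _ _ => hw _ _)]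

lemma sum_sq_eq_quadratic {κ : Type*} [Fintype κ] (M : Matrix κ (Fin n) ℝ) (x : Fin n → ℝ) :
    ∑ p, (M p ⬝ᵥ x) ^ 2 = x ⬝ᵥ (M.transpose * M).mulVec x := by
  rw [← Matrix.mulVec_mulVec, Matrix.dotProduct_mulVec, Matrix.vecMul_transpose]
  exact sum_congr rfl fun p _ => sq _

lemma sum_sq_le_of_dotProduct_le_one {κ : Type*} [Fintype κ] (M : Matrix κ (Fin n) ℝ)
    {u : Fin n → ℝ} (hu : u ⬝ᵥ u ≤ 1) : ∑ p, (M p ⬝ᵥ u) ^ 2 ≤ ∑ i, ∑ p, M p i ^ 2 := by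
  rw [sum_comm]
  refine sum_le_sum fun p _ => ?_
  calc (M p ⬝ᵥ u) ^ 2 ≤ (∑ i, M p i ^ 2) * ∑ i, u i ^ 2 := sum_mul_sq_le_sq_mul_sq _ _ _
    _ ≤ (∑ i, M p i ^ 2) * 1 := by
        refine mul_le_mul_of_nonneg_left ?_ (sum_nonneg fun _ _ => sq_nonneg _)
        simpa [dotProduct, sq] using hu
    _ = _ := mul_one _

open scoped MatrixOrder in
lemma quadratic_le_trace {G : Matrix (Fin n) (Fin n) ℝ} (hG : G.PosSemidef) {u : Fin n → ℝ}
    (hu : u ⬝ᵥ u ≤ 1) : u ⬝ᵥ G.mulVec u ≤ ∑ i, G i i := by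
  obtain ⟨B, rfl⟩ := CStarAlgebra.nonneg_iff_eq_star_mul_self.mp hG.nonneg
  have h := sum_sq_le_of_dotProduct_le_one B hu
  rw [sum_sq_eq_quadratic] at h
  simpa [Matrix.star_eq_conjTranspose, Matrix.mul_apply, sq] using h

lemma mul_quadratic_le {G : Matrix (Fin n) (Fin n) ℝ} (hG : G.PosSemidef) {u : Fin n → ℝ}
    (hu : u ⬝ᵥ u ≤ 1) {a : ℝ} (ha : 0 ≤ a) {v : Fin n → ℝ} (hv : ∀ i, a ≤ v i) :
    a * (u ⬝ᵥ G.mulVec u) ≤ ∑ i, v i * G i i :=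
  calc a * (u ⬝ᵥ G.mulVec u) ≤ a * ∑ i, G i i :=
        mul_le_mul_of_nonneg_left (quadratic_le_trace hG hu) ha
    _ = ∑ i, a * G i i := mul_sum _ _ _
    _ ≤ _ := sum_le_sum fun i _ => mul_le_mul_of_nonneg_right (hv i) hG.diag_nonneg

lemma single_quadratic (G : Matrix (Fin n) (Fin n) ℝ) (i : Fin n) :
    (Pi.single i 1 : Fin n → ℝ) ⬝ᵥ G.mulVec (Pi.single i 1) = G i i := by
  simp

/-- Inserting a fixed vector `u` of norm at most one in place of each argument in turn lowers the
energy, after summation over the arguments. By induction on the number of arguments, the difference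
of the two sides for the last `r` arguments is a positive semidefinite quadratic form in the first
one; at `u` the subtracted part of that form vanishes by alternation, and its trace dominates its
value at `u`. -/
theorem mul_sum_energy_contract_le {a : ℝ} (ha : 0 ≤ a) {u : Fin n → ℝ} (hu : u ⬝ᵥ u ≤ 1)
    {w : Fin (r + 1) → Fin n → ℝ} (hw : ∀ l i, a ≤ w l i)
    (Φ : ι → (Fin n → ℝ) [⋀^Fin (r + 1)]→ₗ[ℝ] ℝ) :
    a * ∑ l : Fin (r + 1), energy (fun j => w (l.succAbove j)) (contract Φ u) ≤ energy w Φ := by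
  induction r with
  | zero =>
    have hq (x : Fin n → ℝ) := energy_contract (w := fun j : Fin 0 => w j.succ)
      (fun _ _ => ha.trans (hw _ _)) Φ x
    simp only [sum_sq_eq_quadratic] at hq
    set G := (contractMatrix (fun j : Fin 0 => w j.succ) Φ).transpose *
      contractMatrix (fun j : Fin 0 => w j.succ) Φ
    have hG : G.PosSemidef := by
      simpa using Matrix.posSemidef_conjTranspose_mul_self
        (contractMatrix (fun j : Fin 0 => w j.succ) Φ)
    rw [energy_succ]
    simp only [Fin.sum_univ_succ, Finset.univ_eq_empty, sum_empty, add_zero, Fin.succAbove_zero, hq,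
      single_quadratic]
    exact mul_quadratic_le hG hu ha (hw 0)
  | succ r ih =>
    have hw0 (l i) : 0 ≤ w l i := ha.trans (hw l i)
    let N := contractMatrix (fun j => w j.succ) Φ
    let N' (l : Fin (r + 1)) := contractMatrix (fun j => w (l.succAbove j).succ) (contract Φ u)
    let G := N.transpose * N - a • ∑ l, (N' l).transpose * N' l
    have hG (x : Fin n → ℝ) : x ⬝ᵥ G.mulVec x = energy (fun j => w j.succ) (contract Φ x) -
        a * ∑ l : Fin (r + 1),
          energy (fun j => w (l.succAbove j).succ) (contract (contract Φ u) x) := by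
      simp only [energy_contract (fun _ _ => hw0 _ _), sum_sq_eq_quadratic, G, N, N',
        Matrix.sub_mulVec, Matrix.smul_mulVec, Matrix.sum_mulVec, dotProduct_sub,
        dotProduct_smul, dotProduct_sum, smul_eq_mul]
    -- Nonnegativity of the form `G` is the induction hypothesis for `contract Φ x`.
    have hpos : G.PosSemidef := by
      refine .of_dotProduct_mulVec_nonneg ?_ fun x => ?_
      · rw [Matrix.IsHermitian, Matrix.conjTranspose_eq_transpose_of_trivial]
        simp [G, Matrix.transpose_sub, Matrix.transpose_sum, Matrix.transpose_mul]
      · have := ih (w := fun j => w j.succ) (fun l i => hw _ _) (contract Φ x)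
        simp only [energy_contract_comm _ Φ x u] at this
        rw [star_trivial, hG]
        exact sub_nonneg.2 this
    have key := mul_quadratic_le hpos hu ha (hw 0)
    -- At `u` the subtracted terms contain `u` twice.
    have hGu : u ⬝ᵥ G.mulVec u = energy (fun j => w j.succ) (contract Φ u) := by
      simp [hG, energy_contract_self]
    have hGd (i : Fin n) := (single_quadratic G i).symm.trans (hG (Pi.single i 1))
    rw [hGu] at key
    simp only [hGd] at key
    rw [Fin.sum_univ_succ, energy_succ w]
    have hl (l : Fin (r + 1)) :
        energy (fun j => w (l.succ.succAbove j)) (contract Φ u) =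
          ∑ i, w 0 i * energy (fun j => w (l.succAbove j).succ)
            (contract (contract Φ u) (Pi.single i 1)) := by
      rw [energy_succ]
      simp
    simp only [hl, Fin.succAbove_zero]
    have hsplit : ∑ i, w 0 i * (energy (fun j => w j.succ) (contract Φ (Pi.single i 1)) -
        a * ∑ l : Fin (r + 1), energy (fun j => w (l.succAbove j).succ)
          (contract (contract Φ u) (Pi.single i 1))) =
        ∑ i, w 0 i * energy (fun j => w j.succ) (contract Φ (Pi.single i 1)) -
        a * ∑ l : Fin (r + 1), ∑ i, w 0 i * energy (fun j => w (l.succAbove j).succ)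
          (contract (contract Φ u) (Pi.single i 1)) := by
      rw [sum_comm (s := (univ : Finset (Fin (r + 1))))]
      simp only [mul_sub, sum_sub_distrib, mul_sum]
      congr 1
      exact sum_congr rfl fun i _ => sum_congr rfl fun l _ => by ring
    rw [hsplit] at key
    linarith

/-- The quadratic form `x ↦ energy w (contract Φ x)` is spread out: none of its values on the unit
ball exceeds a fraction `O(1 / (r + 1))` of its trace. -/
theorem energy_contract_le {a b : ℝ} (ha : 0 < a) (hab : a ≤ b) {w : Fin r → Fin n → ℝ}
    (hw : ∀ l i, w l i ∈ Set.Icc a b) (Φ : ι → (Fin n → ℝ) [⋀^Fin (r + 1)]→ₗ[ℝ] ℝ)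
    {u : Fin n → ℝ} (hu : u ⬝ᵥ u ≤ 1) :
    (r + 1) * energy w (contract Φ u) ≤
      2 * b / a * ∑ i, energy w (contract Φ (Pi.single i 1)) := by
  have hw0 (l i) : 0 ≤ w l i := ha.le.trans (hw l i).1
  have hb : 0 < b := ha.trans_le hab
  have h1 : energy w (contract Φ u) ≤ ∑ i, energy w (contract Φ (Pi.single i 1)) := by
    have := sum_sq_le_of_dotProduct_le_one (contractMatrix w Φ) hu
    simpa [energy_contract hw0] using this
  have h2 : r * energy w (contract Φ u) ≤
      b / a * ∑ i, energy w (contract Φ (Pi.single i 1)) := by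
    cases r with
    | zero =>
      simp only [Nat.cast_zero, zero_mul]
      exact mul_nonneg (by positivity) (sum_nonneg fun i _ => energy_nonneg hw0 _)
    | succ r =>
      have h3 (i : Fin n) := mul_sum_energy_contract_le ha.le hu (fun l i => (hw l i).1)
        (contract Φ (Pi.single i 1))
      have h4 := sum_le_sum fun i (_ : i ∈ univ) => h3 i
      -- Let the freed argument take over the `l`-th column, whose variances are at most `b`.
      have h5 (l : Fin (r + 1)) : energy w (contract Φ u) ≤ b * ∑ i,
          energy (fun j => w (l.succAbove j)) (contract (contract Φ (Pi.single i 1)) u) := by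
        rw [energy_succAbove w _ l, mul_sum]
        refine sum_le_sum fun i _ => ?_
        rw [energy_contract_comm]
        exact mul_le_mul_of_nonneg_right (hw l i).2 (energy_nonneg (fun _ _ => hw0 _ _) _)
      have h6 := sum_le_sum fun l (_ : l ∈ univ) => h5 l
      simp only [sum_const, card_univ, Fintype.card_fin, nsmul_eq_mul] at h6
      rw [← mul_sum, sum_comm] at h4
      rw [← mul_sum] at h6
      rw [div_mul_eq_mul_div, le_div_iff₀ ha]
      nlinarith
  have h3 : 1 ≤ b / a := (one_le_div ha).2 hab
  have h4 : 0 ≤ ∑ i, energy w (contract Φ (Pi.single i 1)) :=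
    sum_nonneg fun i _ => energy_nonneg hw0 _
  rw [mul_div_assoc]
  nlinarith

end

/-! ### Gaussian quadratic forms and their negative moments -/

section

variable {n : ℕ}

/-- The law of `n` independent standard Gaussian variables. -/
def stdGaussianPi (n : ℕ) : Measure (Fin n → ℝ) := Measure.pi fun _ => gaussianReal 0 1

instance : IsProbabilityMeasure (stdGaussianPi n) := by
  unfold stdGaussianPi
  infer_instance

lemma map_dotProduct_stdGaussianPi (c : Fin n → ℝ) :
    (stdGaussianPi n).map (fun x => c ⬝ᵥ x) =
      (gaussianReal 0 1).map (fun t => √(c ⬝ᵥ c) * t) := by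
  have hmem (i : Fin n) : MemLp (fun t => c i * t) 2 (gaussianReal 0 1) :=
    (memLp_id_gaussianReal 2).const_mul (c i)
  have hmp (i : Fin n) : MeasurePreserving (fun x : Fin n → ℝ => x i) (stdGaussianPi n)
      (gaussianReal 0 1) := measurePreserving_eval _ i
  have hg : HasGaussianLaw (fun x => ∑ i, c i * x i) (stdGaussianPi n) := by
    refine iIndepFun.hasGaussianLaw_fun_sum (X := fun i (x : Fin n → ℝ) => c i * x i) (fun i => ?_)
      (iIndepFun_pi (X := fun i t => c i * t) fun i => (hmem i).aestronglyMeasurable.aemeasurable)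
    have : HasLaw (fun x : Fin n → ℝ => x i) (gaussianReal 0 1) (stdGaussianPi n) :=
      ⟨(hmp i).aemeasurable, (hmp i).map_eq⟩
    exact (gaussianReal_const_mul this (c i)).hasGaussianLaw
  have hmean : ∫ x, ∑ i, c i * x i ∂(stdGaussianPi n) = 0 := by
    rw [integral_finsetSum]
    · refine sum_eq_zero fun i _ => ?_
      have h1 : ∫ x : Fin n → ℝ, x i ∂(stdGaussianPi n) = 0 := by
        have := integral_map (hmp i).aemeasurable (f := fun t : ℝ => t)
          measurable_id.aestronglyMeasurable
        rw [(hmp i).map_eq, integral_id_gaussianReal] at this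
        exact this.symm
      rw [integral_const_mul, h1, mul_zero]
    · intro i _
      exact ((hmem i).comp_measurePreserving (hmp i)).integrable (by norm_num)
  have hvar : Var[fun x => ∑ i, c i * x i; stdGaussianPi n] = c ⬝ᵥ c := by
    have := variance_sum_pi hmem
    have h2 : (∑ i, fun x : Fin n → ℝ => c i * x i) = fun x => ∑ i, c i * x i := by
      ext x; simp
    rw [h2] at this
    refine this.trans (sum_congr rfl fun i _ => ?_)
    rw [variance_const_mul, variance_fun_id_gaussianReal]
    simp [sq]
  have h := hg.map_eq_gaussianReal
  rw [hmean, hvar] at h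
  refine h.trans ?_
  rw [gaussianReal_map_const_mul]
  have hc : 0 ≤ c ⬝ᵥ c := sum_nonneg fun i _ => mul_self_nonneg (c i)
  congr 1
  · simp
  · ext
    simp [Real.sq_sqrt hc, hc]

lemma integral_abs_rpow_gaussianReal {q : ℝ} (hq : -1 < q) :
    ∫ t, |t| ^ q ∂(gaussianReal 0 1) = (√(2 * Real.pi))⁻¹ *
      (2 * ((1 / 2) ^ (-(q + 1) / 2) * (1 / 2) * Real.Gamma ((q + 1) / 2))) := by
  rw [integral_gaussianReal_eq_integral_smul one_ne_zero,
    ← integral_rpow_mul_exp_neg_mul_rpow (p := 2) (by norm_num) hq (by norm_num),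
    ← integral_comp_abs (f := fun y : ℝ => y ^ q * Real.exp (-(1 / 2) * y ^ (2 : ℝ))),
    ← integral_const_mul]
  congr 1 with x
  simp only [gaussianPDFReal, Real.rpow_ofNat, sub_zero, NNReal.coe_one, mul_one, smul_eq_mul,
    sq_abs]
  ring_nf

lemma integral_pow_four_gaussianReal : ∫ t, t ^ 4 ∂(gaussianReal 0 1) = 3 := by
  have h1 : ∫ t : ℝ, t ^ 4 ∂(gaussianReal 0 1) = ∫ t, |t| ^ (4 : ℝ) ∂(gaussianReal 0 1) := by
    congr 1 with x
    rw [Real.rpow_ofNat, Even.pow_abs (by decide)]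
  rw [h1, integral_abs_rpow_gaussianReal (by norm_num)]
  have h2 : Real.Gamma ((4 + 1) / 2) = 3 / 4 * √Real.pi := by
    have : ((4 : ℝ) + 1) / 2 = (1 / 2 + 1) + 1 := by norm_num
    rw [this, Real.Gamma_add_one (by norm_num), Real.Gamma_add_one (by norm_num),
      Real.Gamma_one_half_eq]
    ring
  have h3 : ((1 : ℝ) / 2) ^ (-((4 : ℝ) + 1) / 2) = 4 * √2 := by
    rw [one_div, Real.inv_rpow (by norm_num), ← Real.rpow_neg (by norm_num)]
    have : -(-((4 : ℝ) + 1) / 2) = 2 + 1 / 2 := by norm_num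
    rw [this, Real.rpow_add (by norm_num), ← Real.sqrt_eq_rpow]
    norm_num
  rw [h2, h3, Real.sqrt_mul (by norm_num)]
  have : √Real.pi ≠ 0 := by positivity
  field_simp

/-- The moment `E |ξ| ^ (-1/2)` of a standard Gaussian variable `ξ`, written in the form in which it
arises, as `E (ξ²) ^ (-1/4)`. -/
def gaussianNegMoment : ℝ≥0∞ := ∫⁻ t, ENNReal.ofReal (t ^ 2) ^ (-(1 / 4) : ℝ) ∂(gaussianReal 0 1)

lemma gaussianNegMoment_ne_top : gaussianNegMoment ≠ ⊤ := by
  have h : Integrable (fun t : ℝ => |t| ^ (-(1 / 2) : ℝ)) (gaussianReal 0 1) := by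
    -- The integral is a product of positive factors, and a function that is not integrable would
    -- have integral `0`.
    refine not_imp_comm.1 integral_undef ?_
    rw [integral_abs_rpow_gaussianReal (by norm_num)]
    have : 0 < Real.Gamma ((-(1 / 2) + 1) / 2) := Real.Gamma_pos_of_pos (by norm_num)
    positivity
  have h0 : ∀ᵐ t ∂(gaussianReal 0 1), t ≠ 0 := by
    have := nullSingletonClass_gaussianReal (μ := 0) (v := 1) one_ne_zero
    simp [ae_iff]
  have : gaussianNegMoment = ∫⁻ t, ENNReal.ofReal (|t| ^ (-(1 / 2) : ℝ)) ∂(gaussianReal 0 1) := by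
    refine lintegral_congr_ae (h0.mono fun t ht => ?_)
    dsimp only
    rw [ENNReal.ofReal_rpow_of_pos (by positivity), ← sq_abs, ← Real.rpow_natCast,
      ← Real.rpow_mul (abs_nonneg _)]
    norm_num
  rw [this]
  exact h.lintegral_lt_top.ne

/-- Jensen's inequality for `t ↦ t ^ (-p)`, from two applications of the inequality between the
weighted geometric and arithmetic means. -/
lemma rpow_neg_sum_le {κ : Type*} [Fintype κ] {p : ℝ} (hp : 0 < p) {w y : κ → ℝ} (hw : ∀ k, 0 ≤ w k)
    (hw1 : ∑ k, w k = 1) (hy : ∀ k, 0 < y k) :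
    (∑ k, w k * y k) ^ (-p) ≤ ∑ k, w k * y k ^ (-p) := by
  have h1 := Real.geom_mean_le_arith_mean_weighted univ w y (fun k _ => hw k) hw1
    (fun k _ => (hy k).le)
  have h2 := Real.geom_mean_le_arith_mean_weighted univ w (fun k => y k ^ (-p))
    (fun k _ => hw k) hw1 (fun k _ => Real.rpow_nonneg (hy k).le _)
  refine le_trans ?_ h2
  have h3 : ∏ k, (y k ^ (-p)) ^ w k = (∏ k, y k ^ w k) ^ (-p) := by
    rw [← Real.finsetProd_rpow _ _ fun k _ => Real.rpow_nonneg (hy k).le _]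
    refine prod_congr rfl fun k _ => ?_
    rw [← Real.rpow_mul (hy k).le, ← Real.rpow_mul (hy k).le, mul_comm]
  rw [h3]
  exact Real.rpow_le_rpow_of_nonpos (prod_pos fun k _ => Real.rpow_pos_of_pos (hy k) _) h1
    (by linarith)

/-- `rpow_neg_sum_le` with values in `ℝ≥0∞`, where `0 ^ (-p) = ∞` and `0 * ∞ = 0`, so that the `y k`
may vanish. -/
lemma ofReal_rpow_neg_sum_le {κ : Type*} [Fintype κ] {p : ℝ} (hp : 0 < p) {w y : κ → ℝ}
    (hw : ∀ k, 0 ≤ w k) (hw1 : ∑ k, w k = 1) (hy : ∀ k, 0 ≤ y k) :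
    ENNReal.ofReal (∑ k, w k * y k) ^ (-p) ≤
      ∑ k, ENNReal.ofReal (w k) * ENNReal.ofReal (y k) ^ (-p) := by
  -- A vanishing `y k` of positive weight makes the right-hand side infinite.
  by_cases h : ∃ k, 0 < w k ∧ y k = 0
  · obtain ⟨k, hk, hk0⟩ := h
    refine le_trans le_top (le_trans (le_of_eq ?_)
      (single_le_sum (f := fun k => ENNReal.ofReal (w k) * ENNReal.ofReal (y k) ^ (-p))
        (fun _ _ => zero_le) (mem_univ k)))
    simp [hk0, hp, ENNReal.zero_rpow_of_neg, ENNReal.mul_top, hk]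
  push Not at h
  let z : κ → ℝ := fun k => if w k = 0 then 1 else y k
  have hz (k) : 0 < z k := by
    by_cases hk : w k = 0
    · simp [z, hk]
    · simpa [z, hk] using (hy k).lt_of_ne' (h k ((hw k).lt_of_ne' hk))
  have hwz (k) : w k * y k = w k * z k := by
    by_cases hk : w k = 0 <;> simp [z, hk]
  have hwz' (k) : ENNReal.ofReal (w k) * ENNReal.ofReal (y k) ^ (-p) =
      ENNReal.ofReal (w k * z k ^ (-p)) := by
    by_cases hk : w k = 0
    · simp [hk]
    · rw [ENNReal.ofReal_mul (hw k), ENNReal.ofReal_rpow_of_pos]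
      · simp [z, hk]
      · simpa [z, hk] using hz k
  have hpos : 0 < ∑ k, w k * z k := by
    obtain ⟨k, -, hk⟩ : ∃ k ∈ univ, w k ≠ 0 := by
      by_contra! hne
      rw [sum_eq_zero hne] at hw1
      exact zero_ne_one hw1
    exact sum_pos' (fun k _ => mul_nonneg (hw k) (hz k).le)
      ⟨k, mem_univ k, mul_pos ((hw k).lt_of_ne' hk) (hz k)⟩
  simp only [hwz, hwz']
  rw [ENNReal.ofReal_rpow_of_pos hpos, ← ENNReal.ofReal_sum_of_nonneg
    fun k _ => mul_nonneg (hw k) (Real.rpow_nonneg (hz k).le _)]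
  exact ENNReal.ofReal_le_ofReal (rpow_neg_sum_le hp hw hw1 hz)

lemma ofReal_rpow_neg_le {s : ℝ} (hs : 0 < s) (hs1 : s ≤ 1) {R : ℝ} (hR : 0 ≤ R) :
    ENNReal.ofReal R ^ (-s) ≤ 1 + ENNReal.ofReal R ^ (-s) * ENNReal.ofReal |1 - R| := by
  rcases hR.eq_or_lt with rfl | hR
  · simp [hs, ENNReal.zero_rpow_of_neg]
  rcases le_total 1 R with h1 | h1
  · refine le_add_right ?_
    rw [ENNReal.ofReal_rpow_of_pos hR]
    exact ENNReal.ofReal_le_one.2 (Real.rpow_le_one_of_one_le_of_nonpos h1 (by linarith))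
  · have h0 := Real.rpow_nonneg hR.le (-s)
    rw [ENNReal.ofReal_rpow_of_pos hR, ← ENNReal.ofReal_mul h0, ← ENNReal.ofReal_one,
      ← ENNReal.ofReal_add zero_le_one (by positivity)]
    refine ENNReal.ofReal_le_ofReal ?_
    rw [abs_of_nonneg (by linarith)]
    -- For `R ≤ 1` use `R ^ (-s) - 1 = R ^ (-s) * (1 - R ^ s)` and `R ≤ R ^ s`.
    have h2 : R ≤ R ^ s := by
      simpa using Real.rpow_le_rpow_of_exponent_ge hR h1 hs1
    have h3 : R ^ (-s) * R ^ s = 1 := by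
      rw [← Real.rpow_add hR]; simp
    nlinarith [mul_le_mul_of_nonneg_left h2 h0]

lemma continuous_dotProduct_left (c : Fin n → ℝ) : Continuous fun x : Fin n → ℝ => c ⬝ᵥ x := by
  unfold dotProduct
  fun_prop

lemma memLp_dotProduct (c : Fin n → ℝ) (p : ℝ≥0) :
    MemLp (fun x : Fin n → ℝ => c ⬝ᵥ x) p (stdGaussianPi n) := by
  have h := memLp_map_measure_iff (μ := stdGaussianPi n) (g := (id : ℝ → ℝ)) (p := p)
    (f := fun x => c ⬝ᵥ x) measurable_id.aestronglyMeasurable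
    (continuous_dotProduct_left c).measurable.aemeasurable
  refine h.1 ?_
  rw [map_dotProduct_stdGaussianPi, gaussianReal_map_const_mul]
  exact memLp_id_gaussianReal p

lemma integrable_dotProduct_pow_four (c : Fin n → ℝ) :
    Integrable (fun x : Fin n → ℝ => (c ⬝ᵥ x) ^ 4) (stdGaussianPi n) := by
  have := (memLp_dotProduct c 4).integrable_norm_pow (by norm_num)
  simpa [Even.pow_abs (show Even 4 by decide)] using this

lemma integral_dotProduct_sq (c : Fin n → ℝ) :
    ∫ x, (c ⬝ᵥ x) ^ 2 ∂(stdGaussianPi n) = c ⬝ᵥ c := by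
  have hc : 0 ≤ c ⬝ᵥ c := sum_nonneg fun i _ => mul_self_nonneg (c i)
  rw [← integral_map (φ := fun x => c ⬝ᵥ x) (f := fun t : ℝ => t ^ 2)
    (continuous_dotProduct_left c).measurable.aemeasurable (by fun_prop),
    map_dotProduct_stdGaussianPi, integral_map (by fun_prop) (by fun_prop)]
  simp only [mul_pow, Real.sq_sqrt hc]
  rw [integral_const_mul]
  have h := variance_fun_id_gaussianReal (μ := 0) (v := 1)
  rw [variance_of_integral_eq_zero (by fun_prop) (by simp)] at h
  simp [h]

lemma integral_dotProduct_pow_four (c : Fin n → ℝ) :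
    ∫ x, (c ⬝ᵥ x) ^ 4 ∂(stdGaussianPi n) = 3 * (c ⬝ᵥ c) ^ 2 := by
  have hc : 0 ≤ c ⬝ᵥ c := sum_nonneg fun i _ => mul_self_nonneg (c i)
  rw [← integral_map (φ := fun x => c ⬝ᵥ x) (f := fun t : ℝ => t ^ 4)
    (continuous_dotProduct_left c).measurable.aemeasurable (by fun_prop),
    map_dotProduct_stdGaussianPi, integral_map (by fun_prop) (by fun_prop)]
  have h4 : √(c ⬝ᵥ c) ^ 4 = (c ⬝ᵥ c) ^ 2 := by
    rw [show 4 = 2 * 2 by rfl, pow_mul, Real.sq_sqrt hc]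
  simp only [mul_pow, h4]
  rw [integral_const_mul, integral_pow_four_gaussianReal, mul_comm]

/-- Polarization: mixed fourth moments of linear forms reduce to fourth moments of single linear
forms, for which only one-dimensional Gaussian laws are needed. -/
lemma dotProduct_sq_mul_sq_eq (c d x : Fin n → ℝ) : (c ⬝ᵥ x) ^ 2 * (d ⬝ᵥ x) ^ 2 =
    ((c + d) ⬝ᵥ x) ^ 4 / 12 + ((c - d) ⬝ᵥ x) ^ 4 / 12 + (c ⬝ᵥ x) ^ 4 / (-6) +
      (d ⬝ᵥ x) ^ 4 / (-6) := by
  rw [add_dotProduct, sub_dotProduct]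
  ring

lemma integrable_dotProduct_sq_mul_sq (c d : Fin n → ℝ) :
    Integrable (fun x => (c ⬝ᵥ x) ^ 2 * (d ⬝ᵥ x) ^ 2) (stdGaussianPi n) := by
  simp only [dotProduct_sq_mul_sq_eq]
  have h (e : Fin n → ℝ) (t : ℝ) := (integrable_dotProduct_pow_four e).div_const t
  exact (((h _ _).add (h _ _)).add (h _ _)).add (h _ _)

lemma integral_dotProduct_sq_mul_sq (c d : Fin n → ℝ) :
    ∫ x, (c ⬝ᵥ x) ^ 2 * (d ⬝ᵥ x) ^ 2 ∂(stdGaussianPi n) =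
      (c ⬝ᵥ c) * (d ⬝ᵥ d) + 2 * (c ⬝ᵥ d) ^ 2 := by
  simp only [dotProduct_sq_mul_sq_eq]
  have h (e : Fin n → ℝ) (t : ℝ) := (integrable_dotProduct_pow_four e).div_const t
  rw [integral_add (((h _ _).fun_add (h _ _)).fun_add (h _ _)) (h _ _),
    integral_add ((h _ _).fun_add (h _ _)) (h _ _), integral_add (h _ _) (h _ _)]
  simp only [integral_div, integral_dotProduct_pow_four]
  simp only [add_dotProduct, sub_dotProduct, dotProduct_add, dotProduct_sub, dotProduct_comm d c]
  ring

variable {κ : Type*} [Fintype κ]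

lemma integrable_dotProduct_sq (c : Fin n → ℝ) :
    Integrable (fun x => (c ⬝ᵥ x) ^ 2) (stdGaussianPi n) :=
  (memLp_dotProduct c 2).integrable_sq

lemma integral_sum_sq (M : κ → Fin n → ℝ) :
    ∫ x, ∑ p, (M p ⬝ᵥ x) ^ 2 ∂(stdGaussianPi n) = ∑ p, M p ⬝ᵥ M p := by
  rw [integral_finsetSum _ fun p _ => integrable_dotProduct_sq _]
  exact sum_congr rfl fun p _ => integral_dotProduct_sq _

lemma lintegral_sum_sq (M : κ → Fin n → ℝ) :
    ∫⁻ x, ENNReal.ofReal (∑ p, (M p ⬝ᵥ x) ^ 2) ∂(stdGaussianPi n) =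
      ENNReal.ofReal (∑ p, M p ⬝ᵥ M p) := by
  rw [← integral_sum_sq, ofReal_integral_eq_lintegral_ofReal
    (integrable_finsetSum _ fun p _ => integrable_dotProduct_sq _)
    (ae_of_all _ fun x => sum_nonneg fun _ _ => sq_nonneg _)]

lemma integrable_sum_sq_sub_sq (M : κ → Fin n → ℝ) (t : ℝ) :
    Integrable (fun x => (∑ p, (M p ⬝ᵥ x) ^ 2 - t) ^ 2) (stdGaussianPi n) := by
  simp only [sub_sq, sq (∑ p, _), sum_mul_sum]
  refine (Integrable.sub ?_ ?_).add (integrable_const _)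
  · exact integrable_finsetSum _ fun p _ => integrable_finsetSum _ fun q _ =>
      integrable_dotProduct_sq_mul_sq _ _
  · exact ((integrable_finsetSum _ fun p _ => integrable_dotProduct_sq _).const_mul _).mul_const _

/-- The variance of a Gaussian quadratic form. -/
lemma integral_sum_sq_sub_sq (M : κ → Fin n → ℝ) :
    ∫ x, (∑ p, (M p ⬝ᵥ x) ^ 2 - ∑ p, M p ⬝ᵥ M p) ^ 2 ∂(stdGaussianPi n) =
      2 * ∑ p, ∑ q, (M p ⬝ᵥ M q) ^ 2 := by
  set t := ∑ p, M p ⬝ᵥ M p with ht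
  have h1 : Integrable (fun x => ∑ p, ∑ q, (M p ⬝ᵥ x) ^ 2 * (M q ⬝ᵥ x) ^ 2) (stdGaussianPi n) :=
    integrable_finsetSum _ fun p _ => integrable_finsetSum _ fun q _ =>
      integrable_dotProduct_sq_mul_sq _ _
  have h2 : Integrable (fun x => 2 * (∑ p, (M p ⬝ᵥ x) ^ 2) * t) (stdGaussianPi n) :=
    ((integrable_finsetSum _ fun p _ => integrable_dotProduct_sq _).const_mul _).mul_const _
  simp only [sub_sq, sq (∑ p, _), sum_mul_sum]
  have h12 : Integrable (fun x => ∑ p, ∑ q, (M p ⬝ᵥ x) ^ 2 * (M q ⬝ᵥ x) ^ 2 -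
      2 * (∑ p, (M p ⬝ᵥ x) ^ 2) * t) (stdGaussianPi n) := h1.sub h2
  rw [integral_add h12 (integrable_const _), integral_sub h1 h2,
    integral_finsetSum _ fun p _ => integrable_finsetSum _ fun q _ =>
      integrable_dotProduct_sq_mul_sq _ _]
  have h3 : ∑ p, ∫ x, ∑ q, (M p ⬝ᵥ x) ^ 2 * (M q ⬝ᵥ x) ^ 2 ∂(stdGaussianPi n) =
      t * t + 2 * ∑ p, ∑ q, (M p ⬝ᵥ M q) ^ 2 := by
    rw [ht, sum_mul_sum, mul_sum, ← sum_add_distrib]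
    refine sum_congr rfl fun p _ => ?_
    rw [integral_finsetSum _ fun q _ => integrable_dotProduct_sq_mul_sq _ _, mul_sum,
      ← sum_add_distrib]
    exact sum_congr rfl fun q _ => integral_dotProduct_sq_mul_sq _ _
  rw [h3, integral_mul_const, integral_const_mul, integral_sum_sq, ← ht]
  simp
  ring

/-- Jensen's inequality with weights `|M p|²` reduces the negative moment of a normalized Gaussian
quadratic form to that of a single Gaussian variable. -/
lemma lintegral_rpow_neg_le (M : κ → Fin n → ℝ) (hM : ∑ p, M p ⬝ᵥ M p = 1) :
    ∫⁻ x, ENNReal.ofReal (∑ p, (M p ⬝ᵥ x) ^ 2) ^ (-(1 / 4) : ℝ) ∂(stdGaussianPi n) ≤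
      gaussianNegMoment := by
  have hnn (c : Fin n → ℝ) : 0 ≤ c ⬝ᵥ c := sum_nonneg fun i _ => mul_self_nonneg (c i)
  have hpt (x : Fin n → ℝ) : ENNReal.ofReal (∑ p, (M p ⬝ᵥ x) ^ 2) ^ (-(1 / 4) : ℝ) ≤
      ∑ p, ENNReal.ofReal (M p ⬝ᵥ M p) *
        ENNReal.ofReal ((M p ⬝ᵥ x) ^ 2 / (M p ⬝ᵥ M p)) ^ (-(1 / 4) : ℝ) := by
    refine le_of_eq_of_le ?_ (ofReal_rpow_neg_sum_le (by norm_num) (fun p => hnn (M p)) hM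
      fun p => div_nonneg (sq_nonneg _) (hnn _))
    congr 2
    refine sum_congr rfl fun p _ => ?_
    -- A zero row contributes `0` on both sides, whatever the value of the quotient `0 / 0`.
    by_cases h0 : M p ⬝ᵥ M p = 0
    · rw [dotProduct_self_eq_zero.1 h0]
      simp
    · rw [mul_div_cancel₀ _ h0]
  refine (lintegral_mono hpt).trans ?_
  have hmeas (p : κ) : Measurable fun x : Fin n → ℝ =>
      ENNReal.ofReal ((M p ⬝ᵥ x) ^ 2 / (M p ⬝ᵥ M p)) ^ (-(1 / 4) : ℝ) := by
    have := (continuous_dotProduct_left (M p)).measurable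
    fun_prop
  rw [lintegral_finsetSum _ fun p _ => (hmeas p).const_mul _]
  have hterm (p : κ) : ∫⁻ x, ENNReal.ofReal (M p ⬝ᵥ M p) *
      ENNReal.ofReal ((M p ⬝ᵥ x) ^ 2 / (M p ⬝ᵥ M p)) ^ (-(1 / 4) : ℝ) ∂(stdGaussianPi n) =
      ENNReal.ofReal (M p ⬝ᵥ M p) * gaussianNegMoment := by
    rw [lintegral_const_mul _ (hmeas p)]
    rcases (hnn (M p)).eq_or_lt with h0 | h0
    · simp [← h0]
    congr 1
    rw [← lintegral_map (g := fun x => M p ⬝ᵥ x)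
      (f := fun t => ENNReal.ofReal (t ^ 2 / (M p ⬝ᵥ M p)) ^ (-(1 / 4) : ℝ)) (by fun_prop)
      (continuous_dotProduct_left (M p)).measurable, map_dotProduct_stdGaussianPi,
      lintegral_map (by fun_prop) (by fun_prop)]
    simp only [mul_pow, Real.sq_sqrt h0.le, mul_div_cancel_left₀ _ h0.ne', gaussianNegMoment]
  rw [sum_congr rfl fun p _ => hterm p, ← sum_mul,
    ← ENNReal.ofReal_sum_of_nonneg fun p _ => hnn (M p), hM]
  simp

lemma lintegral_rpow_neg_le_of_normalized (M : κ → Fin n → ℝ) (hM : ∑ p, M p ⬝ᵥ M p = 1)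
    {θ : ℝ} (hθ : ∑ p, ∑ q, (M p ⬝ᵥ M q) ^ 2 ≤ θ) :
    ∫⁻ x, ENNReal.ofReal (∑ p, (M p ⬝ᵥ x) ^ 2) ^ (-(1 / 8) : ℝ) ∂(stdGaussianPi n) ≤
      1 + gaussianNegMoment ^ (1 / 2 : ℝ) * ENNReal.ofReal (2 * θ) ^ (1 / 2 : ℝ) := by
  have hq : Measurable fun x : Fin n → ℝ => ∑ p, (M p ⬝ᵥ x) ^ 2 :=
    Finset.measurable_fun_sum _ fun p _ => (continuous_dotProduct_left (M p)).measurable.pow_const 2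
  refine (lintegral_mono fun x => ofReal_rpow_neg_le (by norm_num) (by norm_num)
    (sum_nonneg fun p _ => sq_nonneg (M p ⬝ᵥ x))).trans ?_
  rw [lintegral_add_left measurable_const]
  refine add_le_add (by simp) ?_
  refine (ENNReal.lintegral_mul_le_Lp_mul_Lq (stdGaussianPi n) Real.HolderConjugate.two_two
    (f := fun x => ENNReal.ofReal (∑ p, (M p ⬝ᵥ x) ^ 2) ^ (-(1 / 8) : ℝ))
    (g := fun x => ENNReal.ofReal |1 - ∑ p, (M p ⬝ᵥ x) ^ 2|)
    (by fun_prop) (by fun_prop)).trans ?_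
  gcongr
  · refine le_trans (le_of_eq ?_) (lintegral_rpow_neg_le M hM)
    congr 1 with x
    rw [← ENNReal.rpow_mul]
    norm_num
  · have h := integral_sum_sq_sub_sq M
    rw [hM] at h
    have h2 : ∫⁻ x, ENNReal.ofReal |1 - ∑ p, (M p ⬝ᵥ x) ^ 2| ^ (2 : ℝ) ∂(stdGaussianPi n) =
        ENNReal.ofReal (2 * ∑ p, ∑ q, (M p ⬝ᵥ M q) ^ 2) := by
      rw [← h, ofReal_integral_eq_lintegral_ofReal (integrable_sum_sq_sub_sq M 1)
        (ae_of_all _ fun x => sq_nonneg _)]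
      congr 1 with x
      rw [ENNReal.ofReal_rpow_of_nonneg (abs_nonneg _) (by norm_num), Real.rpow_two, sq_abs,
        ← neg_sq, neg_sub]
    rw [h2]
    exact ENNReal.ofReal_le_ofReal (by linarith)

/-- If the variance of a Gaussian quadratic form is at most `2 θ` times the square of its mean, then
the moment of order `-1/8` exceeds the power of the mean by a factor of at most `1 + O(√θ)`. -/
theorem lintegral_rpow_neg_le_of_sum_sq_le (M : κ → Fin n → ℝ) {θ : ℝ}
    (hθ : ∑ p, ∑ q, (M p ⬝ᵥ M q) ^ 2 ≤ θ * (∑ p, M p ⬝ᵥ M p) ^ 2) :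
    ∫⁻ x, ENNReal.ofReal (∑ p, (M p ⬝ᵥ x) ^ 2) ^ (-(1 / 8) : ℝ) ∂(stdGaussianPi n) ≤
      (1 + gaussianNegMoment ^ (1 / 2 : ℝ) * ENNReal.ofReal (2 * θ) ^ (1 / 2 : ℝ)) *
        ENNReal.ofReal (∑ p, M p ⬝ᵥ M p) ^ (-(1 / 8) : ℝ) := by
  have hnn : 0 ≤ ∑ p, M p ⬝ᵥ M p :=
    sum_nonneg fun p _ => sum_nonneg fun i _ => mul_self_nonneg (M p i)
  set t := ∑ p, M p ⬝ᵥ M p with ht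
  rcases hnn.eq_or_lt with h0 | h0
  -- A vanishing mean makes the right-hand side infinite.
  · rw [← h0]
    refine le_top.trans (le_of_eq ?_)
    rw [ENNReal.ofReal_zero, ENNReal.zero_rpow_of_neg (by norm_num), ENNReal.mul_top (by simp)]
  let N : κ → Fin n → ℝ := fun p => (√t)⁻¹ • M p
  have hs : (√t)⁻¹ * (√t)⁻¹ = t⁻¹ := by rw [← mul_inv, Real.mul_self_sqrt hnn]
  have hNN (p q : κ) : N p ⬝ᵥ N q = t⁻¹ * (M p ⬝ᵥ M q) := by
    simp only [N, smul_dotProduct, dotProduct_smul, smul_eq_mul, ← mul_assoc, hs]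
  have hN : ∑ p, N p ⬝ᵥ N p = 1 := by
    simp only [hNN, ← mul_sum]
    exact inv_mul_cancel₀ h0.ne'
  have hNθ : ∑ p, ∑ q, (N p ⬝ᵥ N q) ^ 2 ≤ θ := by
    simp only [hNN, mul_pow, ← mul_sum]
    rw [inv_pow, inv_mul_le_iff₀ (by positivity)]
    linarith
  have hx (x : Fin n → ℝ) : ENNReal.ofReal (∑ p, (M p ⬝ᵥ x) ^ 2) ^ (-(1 / 8) : ℝ) =
      ENNReal.ofReal (∑ p, (N p ⬝ᵥ x) ^ 2) ^ (-(1 / 8) : ℝ) *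
        ENNReal.ofReal t ^ (-(1 / 8) : ℝ) := by
    rw [← ENNReal.mul_rpow_of_ne_top ENNReal.ofReal_ne_top ENNReal.ofReal_ne_top,
      ← ENNReal.ofReal_mul (sum_nonneg fun _ _ => sq_nonneg _)]
    congr 2
    simp only [N, smul_dotProduct, smul_eq_mul, mul_pow, ← mul_sum, sq (√t)⁻¹, hs]
    field_simp
  simp only [hx]
  have hq : Measurable fun x : Fin n → ℝ => ∑ p, (N p ⬝ᵥ x) ^ 2 :=
    Finset.measurable_fun_sum _ fun p _ => (continuous_dotProduct_left (N p)).measurable.pow_const 2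
  rw [lintegral_mul_const _ (by fun_prop)]
  gcongr
  exact lintegral_rpow_neg_le_of_normalized N hN hNθ

end

/-! ### Integrating out the columns one at a time -/

section

variable {ι : Type*} [Fintype ι] {n r : ℕ}

lemma lintegral_pi_succ {α : Type*} [MeasurableSpace α] (μ : Measure α) [SigmaFinite μ]
    {F : (Fin (r + 1) → α) → ℝ≥0∞} (hF : Measurable F) :
    ∫⁻ x, F x ∂(Measure.pi fun _ : Fin (r + 1) => μ) =
      ∫⁻ y, ∫⁻ z, F (Fin.cons y z) ∂(Measure.pi fun _ : Fin r => μ) ∂μ := by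
  have h := (measurePreserving_piFinSuccAbove (fun _ : Fin (r + 1) => μ) 0).symm
  rw [← h.lintegral_comp hF, lintegral_prod _ (by fun_prop)]
  refine lintegral_congr fun y => lintegral_congr fun z => congrArg F ?_
  exact Fin.insertNth_zero' y z

lemma energy_contract_le_mul {a b : ℝ} (ha : 0 < a) (hab : a ≤ b) {w : Fin r → Fin n → ℝ}
    (hw : ∀ l i, w l i ∈ Set.Icc a b) (Φ : ι → (Fin n → ℝ) [⋀^Fin (r + 1)]→ₗ[ℝ] ℝ)
    (u : Fin n → ℝ) :
    (r + 1) * energy w (contract Φ u) ≤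
      2 * b / a * (∑ i, energy w (contract Φ (Pi.single i 1))) * (u ⬝ᵥ u) := by
  have hw0 (l i) : 0 ≤ w l i := ha.le.trans (hw l i).1
  have hu : 0 ≤ u ⬝ᵥ u := sum_nonneg fun i _ => mul_self_nonneg (u i)
  rcases hu.eq_or_lt with h0 | h0
  · rw [energy_contract hw0]
    rw [dotProduct_self_eq_zero.1 h0.symm]
    simp
  have h1 : ((√(u ⬝ᵥ u))⁻¹ • u) ⬝ᵥ ((√(u ⬝ᵥ u))⁻¹ • u) ≤ 1 := by
    rw [smul_dotProduct, dotProduct_smul, smul_eq_mul, smul_eq_mul, ← mul_assoc, ← mul_inv,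
      Real.mul_self_sqrt hu, inv_mul_cancel₀ h0.ne']
  have h2 := energy_contract_le ha hab hw Φ h1
  have h3 : energy w (contract Φ ((√(u ⬝ᵥ u))⁻¹ • u)) = (u ⬝ᵥ u)⁻¹ * energy w (contract Φ u) := by
    simp only [energy_contract hw0, dotProduct_smul, smul_eq_mul, mul_pow, inv_pow, Real.sq_sqrt hu,
      ← mul_sum]
  rw [h3] at h2
  calc (r + 1) * energy w (contract Φ u)
      = ((r + 1) * ((u ⬝ᵥ u)⁻¹ * energy w (contract Φ u))) * (u ⬝ᵥ u) := by field_simp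
    _ ≤ _ := mul_le_mul_of_nonneg_right h2 hu

/-- The factor lost in the moment of order `-1/8` when a column is averaged out while `p` others
have already been; it is `1 + O(1 / √(p + 1))`. -/
def columnFactor (a b : ℝ) (p : ℕ) : ℝ≥0∞ :=
  1 + gaussianNegMoment ^ (1 / 2 : ℝ) *
    ENNReal.ofReal (2 * (2 * (b / a) ^ 3 / (p + 1))) ^ (1 / 2 : ℝ)

lemma energy_contract_scale {w : Fin r → Fin n → ℝ} (hw : ∀ l i, 0 ≤ w l i)
    (Φ : ι → (Fin n → ℝ) [⋀^Fin (r + 1)]→ₗ[ℝ] ℝ) (v x : Fin n → ℝ) :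
    energy w (contract Φ fun i => √(v i) * x i) =
      ∑ p, ((fun i => contractMatrix w Φ p i * √(v i)) ⬝ᵥ x) ^ 2 := by
  rw [energy_contract hw]
  simp only [dotProduct, mul_assoc]

lemma sum_mul_energy_contract_single {w : Fin r → Fin n → ℝ} (hw : ∀ l i, 0 ≤ w l i)
    (Φ : ι → (Fin n → ℝ) [⋀^Fin (r + 1)]→ₗ[ℝ] ℝ) {v : Fin n → ℝ} (hv : ∀ i, 0 ≤ v i) :
    ∑ p, (fun i => contractMatrix w Φ p i * √(v i)) ⬝ᵥ
        (fun i => contractMatrix w Φ p i * √(v i)) =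
      ∑ i, v i * energy w (contract Φ (Pi.single i 1)) := by
  simp only [energy_contract hw, dotProduct_single_one, mul_sum]
  rw [sum_comm (s := (univ : Finset (Fin n)))]
  refine sum_congr rfl fun p _ => sum_congr rfl fun i _ => ?_
  rw [mul_mul_mul_comm, Real.mul_self_sqrt (hv i)]
  ring

lemma lintegral_energy_contract {w : Fin r → Fin n → ℝ} (hw : ∀ l i, 0 ≤ w l i)
    (Φ : ι → (Fin n → ℝ) [⋀^Fin (r + 1)]→ₗ[ℝ] ℝ) {v : Fin n → ℝ} (hv : ∀ i, 0 ≤ v i) :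
    ∫⁻ x, ENNReal.ofReal (energy w (contract Φ fun i => √(v i) * x i)) ∂(stdGaussianPi n) =
      ENNReal.ofReal (∑ i, v i * energy w (contract Φ (Pi.single i 1))) := by
  simp only [energy_contract_scale hw, ← sum_mul_energy_contract_single hw Φ hv]
  exact lintegral_sum_sq _

/-- The loss from averaging over one column with variances `v`, given that `r` columns have been
averaged out already. -/
lemma lintegral_energy_contract_rpow_neg_le {a b : ℝ} (ha : 0 < a) (hab : a ≤ b)
    {w : Fin r → Fin n → ℝ} (hw : ∀ l i, w l i ∈ Set.Icc a b)
    (Φ : ι → (Fin n → ℝ) [⋀^Fin (r + 1)]→ₗ[ℝ] ℝ) {v : Fin n → ℝ}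
    (hv : ∀ i, v i ∈ Set.Icc a b) :
    ∫⁻ x, ENNReal.ofReal (energy w (contract Φ fun i => √(v i) * x i)) ^ (-(1 / 8) : ℝ)
        ∂(stdGaussianPi n) ≤
      columnFactor a b r *
        ENNReal.ofReal (∑ i, v i * energy w (contract Φ (Pi.single i 1))) ^ (-(1 / 8) : ℝ) := by
  have hw0 (l i) : 0 ≤ w l i := ha.le.trans (hw l i).1
  have hv0 (i) : 0 ≤ v i := ha.le.trans (hv i).1
  have hb : 0 < b := ha.trans_le hab
  simp only [energy_contract_scale hw0, ← sum_mul_energy_contract_single hw0 Φ hv0]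
  refine lintegral_rpow_neg_le_of_sum_sq_le _ ?_
  rw [sum_mul_energy_contract_single hw0 Φ hv0]
  set C := contractMatrix w Φ
  set T := ∑ i, energy w (contract Φ (Pi.single i 1)) with hT
  have hT0 : 0 ≤ T := sum_nonneg fun i _ => energy_nonneg hw0 _
  have hTC : T = ∑ p, C p ⬝ᵥ C p := by
    simp only [hT, energy_contract hw0, dotProduct_single_one, sq]
    rw [sum_comm]
    rfl
  -- The variance is a sum of values of the quadratic form itself, to which the spread
  -- bound applies.
  have h1 (p) : ∑ q, ((fun i => C p i * √(v i)) ⬝ᵥ fun i => C q i * √(v i)) ^ 2 =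
      energy w (contract Φ fun i => v i * C p i) := by
    rw [energy_contract hw0]
    refine sum_congr rfl fun q _ => congrArg (· ^ 2) (sum_congr rfl fun i _ => ?_)
    rw [mul_mul_mul_comm, Real.mul_self_sqrt (hv0 i)]
    ring
  have h2 (p) : (fun i => v i * C p i) ⬝ᵥ (fun i => v i * C p i) ≤ b ^ 2 * (C p ⬝ᵥ C p) := by
    simp only [dotProduct, mul_sum]
    refine sum_le_sum fun i _ => ?_
    have : v i ^ 2 ≤ b ^ 2 := pow_le_pow_left₀ (hv0 i) (hv i).2 2
    nlinarith [mul_le_mul_of_nonneg_right this (sq_nonneg (C p i))]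
  have h3 (p) : energy w (contract Φ fun i => v i * C p i) ≤
      2 * b / a * T * (b ^ 2 * (C p ⬝ᵥ C p)) / (r + 1) := by
    rw [le_div_iff₀ (by positivity), mul_comm]
    refine (energy_contract_le_mul ha hab hw Φ _).trans ?_
    exact mul_le_mul_of_nonneg_left (h2 p) (by positivity)
  have h4 : a * T ≤ ∑ i, v i * energy w (contract Φ (Pi.single i 1)) := by
    rw [hT, mul_sum]
    exact sum_le_sum fun i _ => mul_le_mul_of_nonneg_right (hv i).1 (energy_nonneg hw0 _)
  simp only [h1]
  calc ∑ p, energy w (contract Φ fun i => v i * C p i)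
      ≤ ∑ p, 2 * b / a * T * (b ^ 2 * (C p ⬝ᵥ C p)) / (r + 1) := sum_le_sum fun p _ => h3 p
    _ = 2 * (b / a) ^ 3 / (r + 1) * (a * T) ^ 2 := by
        rw [← sum_div, ← mul_sum, ← mul_sum, ← hTC]
        field_simp
    _ ≤ _ := by
        refine mul_le_mul_of_nonneg_left ?_ (by positivity)
        exact pow_le_pow_left₀ (by positivity) h4 2

lemma continuous_alternatingMap (f : (Fin n → ℝ) [⋀^Fin r]→ₗ[ℝ] ℝ) : Continuous f := by
  have h (v : Fin r → Fin n → ℝ) :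
      f v = ∑ g : Fin r → Fin n, (∏ l, v l (g l)) * f fun l => Pi.single (g l) 1 := by
    have hv : v = fun l => ∑ i, v l i • (Pi.single i 1 : Fin n → ℝ) := by
      ext l j
      simp [Pi.single_apply]
    conv_lhs => rw [hv]
    have := f.toMultilinearMap.map_sum fun l i => v l i • (Pi.single i 1 : Fin n → ℝ)
    refine this.trans (sum_congr rfl fun g _ => ?_)
    exact f.toMultilinearMap.map_smul_univ _ _
  rw [show (f : (Fin r → Fin n → ℝ) → ℝ) = _ from funext h]
  fun_prop

lemma measurable_sum_sq_scale (w : Fin r → Fin n → ℝ)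
    (Φ : ι → (Fin n → ℝ) [⋀^Fin r]→ₗ[ℝ] ℝ) :
    Measurable fun x : Fin r → Fin n → ℝ => ∑ k, (Φ k fun l i => √(w l i) * x l i) ^ 2 := by
  refine Continuous.measurable (continuous_finsetSum _ fun k _ => Continuous.pow ?_ 2)
  exact (continuous_alternatingMap (Φ k)).comp (by fun_prop)

lemma sum_sq_scale_cons (w : Fin (r + 1) → Fin n → ℝ)
    (Φ : ι → (Fin n → ℝ) [⋀^Fin (r + 1)]→ₗ[ℝ] ℝ) (y : Fin n → ℝ) (z : Fin r → Fin n → ℝ) :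
    ∑ k, (Φ k fun l i => √(w l i) * (Fin.cons y z : Fin (r + 1) → Fin n → ℝ) l i) ^ 2 =
      ∑ k, (contract Φ (fun i => √(w 0 i) * y i) k fun l i => √(w l.succ i) * z l i) ^ 2 := by
  refine sum_congr rfl fun k _ => ?_
  refine congrArg (fun v => Φ k v ^ 2) (funext fun l => ?_)
  refine Fin.cases ?_ (fun l => ?_) l <;> rfl

theorem lintegral_sum_sq_scale {w : Fin r → Fin n → ℝ} (hw : ∀ l i, 0 ≤ w l i)
    (Φ : ι → (Fin n → ℝ) [⋀^Fin r]→ₗ[ℝ] ℝ) :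
    ∫⁻ x, ENNReal.ofReal (∑ k, (Φ k fun l i => √(w l i) * x l i) ^ 2)
      ∂(Measure.pi fun _ : Fin r => stdGaussianPi n) = ENNReal.ofReal (energy w Φ) := by
  induction r with
  | zero =>
    have (x : Fin 0 → Fin n → ℝ) :
        ∑ k, (Φ k fun l i => √(w l i) * x l i) ^ 2 = energy w Φ := by
      simp only [energy, univ_unique, sum_singleton, Finset.univ_eq_empty, prod_empty, one_mul]
      exact sum_congr rfl fun k _ => congrArg (fun v => Φ k v ^ 2) (Subsingleton.elim _ _)
    simp [this]
  | succ r ih =>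
    rw [lintegral_pi_succ _ (measurable_sum_sq_scale w Φ).ennreal_ofReal]
    simp only [sum_sq_scale_cons]
    simp only [ih (w := fun l => w l.succ) (fun _ _ => hw _ _)]
    rw [lintegral_energy_contract (fun _ _ => hw _ _) Φ (hw 0), ← energy_succ]

/-- Lower-tail estimate in the form of a negative moment. The first column is integrated last, so
that the induction hypothesis applies to the forms `contract Φ y` with `y` held fixed. -/
theorem lintegral_sum_sq_scale_rpow_neg_le {a b : ℝ} (ha : 0 < a) (hab : a ≤ b)
    {w : Fin r → Fin n → ℝ} (hw : ∀ l i, w l i ∈ Set.Icc a b)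
    (Φ : ι → (Fin n → ℝ) [⋀^Fin r]→ₗ[ℝ] ℝ) :
    ∫⁻ x, ENNReal.ofReal (∑ k, (Φ k fun l i => √(w l i) * x l i) ^ 2) ^ (-(1 / 8) : ℝ)
      ∂(Measure.pi fun _ : Fin r => stdGaussianPi n) ≤
    (∏ p ∈ range r, columnFactor a b p) * ENNReal.ofReal (energy w Φ) ^ (-(1 / 8) : ℝ) := by
  induction r with
  | zero =>
    have (x : Fin 0 → Fin n → ℝ) :
        ∑ k, (Φ k fun l i => √(w l i) * x l i) ^ 2 = energy w Φ := by
      simp only [energy, univ_unique, sum_singleton, Finset.univ_eq_empty, prod_empty, one_mul]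
      exact sum_congr rfl fun k _ => congrArg (fun v => Φ k v ^ 2) (Subsingleton.elim _ _)
    simp [this]
  | succ r ih =>
    have hw0 (l i) : 0 ≤ w l i := ha.le.trans (hw l i).1
    rw [lintegral_pi_succ _ ((measurable_sum_sq_scale w Φ).ennreal_ofReal.pow_const _)]
    simp only [sum_sq_scale_cons]
    refine (lintegral_mono fun y => ih (w := fun l => w l.succ) (fun _ _ => hw _ _) _).trans ?_
    rw [lintegral_const_mul]
    · rw [prod_range_succ, mul_assoc, energy_succ]
      gcongr
      exact lintegral_energy_contract_rpow_neg_le ha hab (fun _ _ => hw _ _) Φ (hw 0)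
    · simp only [energy_contract_scale (w := fun l => w l.succ) (fun _ _ => hw0 _ _)]
      have : Measurable fun x : Fin n → ℝ => ∑ p,
          ((fun i => contractMatrix (fun l => w l.succ) Φ p i * √(w 0 i)) ⬝ᵥ x) ^ 2 :=
        Finset.measurable_fun_sum _ fun p _ =>
          (continuous_dotProduct_left _).measurable.pow_const 2
      fun_prop

end

/-! ### The Cauchy–Binet formula and the permanent -/

section

variable {n m : ℕ}

/-- An injective map `Fin m → Fin n` is, in a unique way, a permutation followed by an order
embedding. -/
lemma sum_eq_sum_orderEmbedding_perm {M : Type*} [AddCommMonoid M] (F : (Fin m → Fin n) → M)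
    (hF : ∀ f, ¬ Function.Injective f → F f = 0) :
    ∑ f, F f = ∑ α : Fin m ↪o Fin n, ∑ σ : Equiv.Perm (Fin m), F (α ∘ σ) := by
  rw [← Fintype.sum_prod_type'
    (f := fun (α : Fin m ↪o Fin n) (σ : Equiv.Perm (Fin m)) => F (α ∘ σ))]
  symm
  refine Finset.sum_of_injOn (fun p : (Fin m ↪o Fin n) × Equiv.Perm (Fin m) => p.1 ∘ p.2)
    ?_ (by simp) ?_ (fun _ _ => rfl)
  · rintro ⟨α, σ⟩ - ⟨β, τ⟩ - h
    dsimp only at h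
    have hr : Set.range α = Set.range β := by
      rw [← σ.surjective.range_comp α, h, τ.surjective.range_comp]
    have hαβ : α = β := by
      have := (StrictMono.range_inj α.strictMono β.strictMono).1 hr
      exact DFunLike.coe_injective this
    subst hαβ
    refine Prod.ext rfl (Equiv.ext fun i => α.injective (congrFun h i))
  · intro f _ hf
    refine hF f fun hinj => hf ?_
    have hs : StrictMono (f ∘ Tuple.sort f) :=
      (Tuple.monotone_sort f).strictMono_of_injective (hinj.comp (Tuple.sort f).injective)
    refine ⟨(OrderEmbedding.ofStrictMono _ hs, (Tuple.sort f)⁻¹), by simp, ?_⟩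
    ext i
    simp

/-- The Cauchy–Binet formula for `Xᵀ X`. -/
theorem det_transpose_mul_self (X : Matrix (Fin n) (Fin m) ℝ) :
    (X.transpose * X).det = ∑ α : Fin m ↪o Fin n, (X.submatrix α id).det ^ 2 := by
  have h1 : (X.transpose * X).det =
      ∑ f : Fin m → Fin n, (∏ l, X (f l) l) * (X.submatrix f id).det := by
    have hrow : X.transpose * X = fun l => ∑ i, X i l • X i := by
      ext l k
      simp [Matrix.mul_apply]
    rw [hrow]
    refine (Matrix.detRowAlternating.toMultilinearMap.map_sum
      fun (l : Fin m) (i : Fin n) => X i l • X i).trans (sum_congr rfl fun f _ => ?_)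
    exact Matrix.detRowAlternating.toMultilinearMap.map_smul_univ _ _
  rw [h1, sum_eq_sum_orderEmbedding_perm]
  · refine sum_congr rfl fun α _ => ?_
    have h2 (σ : Equiv.Perm (Fin m)) : (X.submatrix (α ∘ σ) id).det =
        σ.sign * (X.submatrix α id).det := by
      rw [← Matrix.det_permute]
      rfl
    simp only [h2]
    rw [sq]
    nth_rewrite 2 [Matrix.det_apply']
    rw [sum_mul]
    refine sum_congr rfl fun σ _ => ?_
    simp
    ring
  · intro f hf
    obtain ⟨i, j, hij, hne⟩ : ∃ i j, f i = f j ∧ i ≠ j := by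
      simpa [Function.Injective] using hf
    rw [Matrix.det_zero_of_row_eq hne (by ext k; simp [hij]), mul_zero]

/-- The minor with rows `α`, as an alternating form in the `m` columns of an `n × m` matrix. -/
def minorForm (n m : ℕ) (α : Fin m ↪o Fin n) : (Fin n → ℝ) [⋀^Fin m]→ₗ[ℝ] ℝ :=
  (Matrix.detRowAlternating (R := ℝ) (n := Fin m)).compLinearMap (LinearMap.funLeft ℝ ℝ α)

lemma minorForm_apply (α : Fin m ↪o Fin n) (v : Fin m → Fin n → ℝ) :
    minorForm n m α v = (Matrix.of fun l i => v l (α i)).det := rfl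

/-- The minors take the values `0` and `±1` at families of standard basis vectors; those with value
`±1` enumerate the terms of the permanent. -/
theorem energy_minorForm (A : Matrix (Fin n) (Fin m) ℝ) :
    energy (fun l i => A i l) (minorForm n m) = rectPermanent A := by
  unfold energy rectPermanent
  simp only [mul_sum]
  rw [sum_comm]
  refine sum_congr rfl fun α _ => ?_
  have hdet (σ : Equiv.Perm (Fin m)) :
      minorForm n m α (fun l => Pi.single (α (σ l)) 1) ^ 2 = 1 := by
    have h : (Matrix.of fun l i => (Pi.single (α (σ l)) 1 : Fin n → ℝ) (α i)) =
        σ.permMatrix ℝ := by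
      ext l i
      simp [Pi.single_apply, PEquiv.toMatrix_apply, eq_comm]
    rw [minorForm_apply, h, Matrix.det_permutation]
    rcases Int.units_eq_one_or σ.sign with h | h <;> simp [h]
  have hinj : Function.Injective fun (σ : Equiv.Perm (Fin m)) (l : Fin m) => α (σ l) :=
    fun σ τ h => Equiv.ext fun l => α.injective (congrFun h l)
  rw [Matrix.permanent]
  symm
  refine Finset.sum_of_injOn (fun (σ : Equiv.Perm (Fin m)) (l : Fin m) => α (σ l))
    hinj.injOn (by simp) ?_ fun σ _ => ?_
  · intro f _ hf
    rw [minorForm_apply]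
    have : (Matrix.of fun l i => (Pi.single (f l) 1 : Fin n → ℝ) (α i)).det = 0 := by
      by_contra hne
      rw [Matrix.det_apply'] at hne
      obtain ⟨σ, -, hσ⟩ := exists_ne_zero_of_sum_ne_zero hne
      have hσ' := prod_ne_zero_iff.1 (right_ne_zero_of_mul hσ)
      refine hf ⟨σ⁻¹, by simp, funext fun l => ?_⟩
      have := hσ' (σ⁻¹ l) (mem_univ _)
      simpa [Pi.single_apply] using this
    simp [this]
  · simp [hdet]

end

/-! ### Tail bounds for the determinant estimator -/

section

variable {n m : ℕ}

lemma rectPermanent_pos {A : Matrix (Fin n) (Fin m) ℝ} (hA : ∀ i j, 0 < A i j) (hmn : m ≤ n) :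
    0 < rectPermanent A := by
  have : Nonempty (Fin m ↪o Fin n) := ⟨Fin.castLEOrderEmb hmn⟩
  exact sum_pos (fun α _ => sum_pos (fun σ _ => prod_pos fun i _ => hA _ _) univ_nonempty)
    univ_nonempty

lemma det_gramMatrix (A : Matrix (Fin n) (Fin m) ℝ) (x : ℕ → ℕ → ℝ) :
    (gramMatrix A x).det =
      ∑ α, (minorForm n m α fun l i => √(A i l) * x i l) ^ 2 := by
  rw [gramMatrix, det_transpose_mul_self]
  refine sum_congr rfl fun α _ => ?_
  rw [minorForm_apply, ← Matrix.det_transpose]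
  rfl

section Law

variable {Ω : Type*} [MeasurableSpace Ω] {P : Measure Ω}
  {x : ℕ → ℕ → Ω → ℝ}

lemma hasLaw_columns [IsProbabilityMeasure P] (hlaw : ∀ i j, HasLaw (x i j) (gaussianReal 0 1) P)
    (hindep : iIndepFun (fun p : ℕ × ℕ => x p.1 p.2) P) (n m : ℕ) :
    HasLaw (fun ω (l : Fin m) (i : Fin n) => x i l ω)
      (Measure.pi fun _ : Fin m => stdGaussianPi n) P := by
  have hinj : Function.Injective fun p : Fin m × Fin n => ((p.2 : ℕ), (p.1 : ℕ)) := by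
    rintro ⟨i, j⟩ ⟨k, l⟩ h
    simp only [Prod.mk.injEq, Fin.val_inj] at h
    exact Prod.ext h.2 h.1
  have h := (hindep.precomp hinj).hasLaw_pi (μ := fun _ => gaussianReal 0 1)
    (fun p : Fin m × Fin n => hlaw p.2 p.1)
  have hc : (Measure.pi fun _ : Fin m × Fin n => gaussianReal 0 1).map
      (MeasurableEquiv.curry (Fin m) (Fin n) ℝ) = Measure.pi fun _ : Fin m => stdGaussianPi n := by
    have := Measure.infinitePi_map_curry (fun (_ : Fin m) (_ : Fin n) => gaussianReal 0 1)
    simpa only [Measure.infinitePi_eq_pi, stdGaussianPi] using this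
  have h2 : HasLaw (MeasurableEquiv.curry (Fin m) (Fin n) ℝ)
      (Measure.pi fun _ : Fin m => stdGaussianPi n)
      (Measure.pi fun _ : Fin m × Fin n => gaussianReal 0 1) :=
    ⟨(MeasurableEquiv.measurable _).aemeasurable, hc⟩
  exact h2.comp h

lemma lintegral_det_gramMatrix [IsProbabilityMeasure P]
    (hlaw : ∀ i j, HasLaw (x i j) (gaussianReal 0 1) P)
    (hindep : iIndepFun (fun p : ℕ × ℕ => x p.1 p.2) P) {A : Matrix (Fin n) (Fin m) ℝ}
    (hA : ∀ i j, 0 ≤ A i j) :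
    ∫⁻ ω, ENNReal.ofReal (gramMatrix A fun i j => x i j ω).det ∂P =
      ENNReal.ofReal (rectPermanent A) := by
  simp only [det_gramMatrix]
  rw [← energy_minorForm, ← lintegral_sum_sq_scale (fun l i => hA i l),
    ← (hasLaw_columns hlaw hindep n m).lintegral_comp
      (measurable_sum_sq_scale _ _).ennreal_ofReal.aemeasurable]

lemma lintegral_det_gramMatrix_rpow_neg_le [IsProbabilityMeasure P]
    (hlaw : ∀ i j, HasLaw (x i j) (gaussianReal 0 1) P)
    (hindep : iIndepFun (fun p : ℕ × ℕ => x p.1 p.2) P) {a b : ℝ} (ha : 0 < a) (hab : a ≤ b)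
    {A : Matrix (Fin n) (Fin m) ℝ} (hA : ∀ i j, A i j ∈ Set.Icc a b) :
    ∫⁻ ω, ENNReal.ofReal (gramMatrix A fun i j => x i j ω).det ^ (-(1 / 8) : ℝ) ∂P ≤
      (∏ p ∈ range m, columnFactor a b p) *
        ENNReal.ofReal (rectPermanent A) ^ (-(1 / 8) : ℝ) := by
  simp only [det_gramMatrix]
  rw [← energy_minorForm]
  refine le_of_eq_of_le ?_
    (lintegral_sum_sq_scale_rpow_neg_le ha hab (fun l i => hA i l) (minorForm n m))
  exact (hasLaw_columns hlaw hindep n m).lintegral_comp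
      ((measurable_sum_sq_scale _ _).ennreal_ofReal.pow_const _).aemeasurable

lemma aemeasurable_det_gramMatrix [IsProbabilityMeasure P]
    (hlaw : ∀ i j, HasLaw (x i j) (gaussianReal 0 1) P)
    (hindep : iIndepFun (fun p : ℕ × ℕ => x p.1 p.2) P) (A : Matrix (Fin n) (Fin m) ℝ) :
    AEMeasurable (fun ω => (gramMatrix A fun i j => x i j ω).det) P := by
  simp only [det_gramMatrix]
  exact (measurable_sum_sq_scale (fun l i => A i l) (minorForm n m)).comp_aemeasurable
    (hasLaw_columns hlaw hindep n m).aemeasurable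

lemma measure_deviationEvent_le [IsProbabilityMeasure P]
    (hlaw : ∀ i j, HasLaw (x i j) (gaussianReal 0 1) P)
    (hindep : iIndepFun (fun p : ℕ × ℕ => x p.1 p.2) P) {a b : ℝ} (ha : 0 < a) (hab : a ≤ b)
    {A : Matrix (Fin n) (Fin m) ℝ} (hA : ∀ i j, A i j ∈ Set.Icc a b) (hmn : m ≤ n) (hn : 0 < n)
    (δ : ℝ) :
    P (deviationEvent x A δ) ≤ ENNReal.ofReal (Real.exp (-(n * δ))) +
      (∏ p ∈ range m, columnFactor a b p) * ENNReal.ofReal (Real.exp (-(n * δ / 8))) := by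
  have hper : 0 < rectPermanent A := rectPermanent_pos (fun i j => ha.trans_le (hA i j).1) hmn
  set t := rectPermanent A with ht
  set D : Ω → ℝ := fun ω => (gramMatrix A fun i j => x i j ω).det with hD
  have hD0 (ω) : 0 ≤ D ω := by
    simp only [hD, det_gramMatrix]
    exact sum_nonneg fun _ _ => sq_nonneg _
  have hDm : AEMeasurable D P := aemeasurable_det_gramMatrix hlaw hindep A
  have hn' : (0 : ℝ) < n := by exact_mod_cast hn
  set up := ENNReal.ofReal (Real.exp (n * δ) * t) with hup
  set lo := ENNReal.ofReal (Real.exp (-(n * δ)) * t) with hlo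
  have hlo0 : 0 < Real.exp (-(n * δ)) * t := by positivity
  have hsub : deviationEvent x A δ ⊆ {ω | up ≤ ENNReal.ofReal (D ω)} ∪
      {ω | lo ^ (-(1 / 8) : ℝ) ≤ ENNReal.ofReal (D ω) ^ (-(1 / 8) : ℝ)} := by
    intro ω hω
    have hcase : D ω = 0 ∨ n * δ < |Real.log (D ω) - Real.log t| := by
      refine hω.imp id fun h => ?_
      rwa [one_div, lt_inv_mul_iff₀ hn'] at h
    have hlow (h : D ω ≤ Real.exp (-(n * δ)) * t) :
        lo ^ (-(1 / 8) : ℝ) ≤ ENNReal.ofReal (D ω) ^ (-(1 / 8) : ℝ) := by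
      rw [ENNReal.rpow_neg, ENNReal.rpow_neg, ENNReal.inv_le_inv]
      exact ENNReal.rpow_le_rpow (ENNReal.ofReal_le_ofReal h) (by norm_num)
    -- Outcomes with `D ω = 0` belong to the second set, as `0 ^ (-1/8) = ∞`.
    rcases (hD0 ω).eq_or_lt with h0 | h0
    · exact Or.inr (hlow (h0 ▸ hlo0.le))
    rcases lt_abs.1 (hcase.resolve_left h0.ne') with h | h
    · refine Or.inl (ENNReal.ofReal_le_ofReal ?_)
      rw [← Real.log_le_log_iff (by positivity) h0, Real.log_mul (Real.exp_ne_zero _) hper.ne',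
        Real.log_exp]
      linarith
    · refine Or.inr (hlow ?_)
      rw [← Real.log_le_log_iff h0 hlo0, Real.log_mul (Real.exp_ne_zero _) hper.ne',
        Real.log_exp]
      linarith
  refine (measure_mono hsub).trans ((measure_union_le _ _).trans (add_le_add ?_ ?_))
  · refine (meas_ge_le_lintegral_div hDm.ennreal_ofReal (by simp; positivity)
      ENNReal.ofReal_ne_top).trans ?_
    rw [lintegral_det_gramMatrix hlaw hindep fun i j => ha.le.trans (hA i j).1]
    refine ENNReal.div_le_of_le_mul (le_of_eq ?_)
    rw [← ENNReal.ofReal_mul (Real.exp_pos _).le, ← mul_assoc, ← Real.exp_add]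
    simp [ht]
  · have hlo1 : lo ^ (-(1 / 8) : ℝ) = ENNReal.ofReal (Real.exp (n * δ / 8)) *
        ENNReal.ofReal t ^ (-(1 / 8) : ℝ) := by
      rw [hlo, ENNReal.ofReal_mul (Real.exp_pos _).le,
        ENNReal.mul_rpow_of_ne_top ENNReal.ofReal_ne_top ENNReal.ofReal_ne_top,
        ENNReal.ofReal_rpow_of_pos (Real.exp_pos _), ← Real.exp_mul]
      congr 3
      ring
    refine (meas_ge_le_lintegral_div (hDm.ennreal_ofReal.pow_const _) ?_ ?_).trans ?_
    · exact (ENNReal.rpow_pos (by simp; positivity) ENNReal.ofReal_ne_top).ne'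
    · rw [hlo, ENNReal.ofReal_rpow_of_pos hlo0]
      exact ENNReal.ofReal_ne_top
    refine ENNReal.div_le_of_le_mul ?_
    refine (lintegral_det_gramMatrix_rpow_neg_le hlaw hindep ha hab hA).trans (le_of_eq ?_)
    rw [hlo1, mul_assoc, ← mul_assoc (ENNReal.ofReal (Real.exp _)),
      ← ENNReal.ofReal_mul (Real.exp_pos _).le, ← Real.exp_add]
    simp [ht]

end Law

lemma sum_inv_sqrt_le (n : ℕ) : ∑ p ∈ range n, 1 / √((p : ℝ) + 1) ≤ 2 * √n := by
  induction n with
  | zero => simp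
  | succ n ih =>
    rw [sum_range_succ]
    push_cast
    have h1 : 0 < √((n : ℝ) + 1) := by positivity
    have h2 : √((n : ℝ) + 1) ^ 2 = n + 1 := Real.sq_sqrt (by positivity)
    have h3 : √(n : ℝ) ^ 2 = n := Real.sq_sqrt (by positivity)
    have h4 : 1 / √((n : ℝ) + 1) ≤ 2 * (√((n : ℝ) + 1) - √n) := by
      rw [div_le_iff₀ h1]
      nlinarith [sq_nonneg (√((n : ℝ) + 1) - √n)]
    linarith

lemma exists_prod_columnFactor_le (a b : ℝ) (ha : 0 < a) (hab : a ≤ b) : ∃ c : ℝ, 0 ≤ c ∧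
    ∀ m : ℕ, ∏ p ∈ range m, columnFactor a b p ≤ ENNReal.ofReal (Real.exp (c * (2 * √m))) := by
  have hb : 0 < b := ha.trans_le hab
  refine ⟨√gaussianNegMoment.toReal * √(4 * (b / a) ^ 3), by positivity,
    fun m => ?_⟩
  set c := √gaussianNegMoment.toReal * √(4 * (b / a) ^ 3) with hc
  have hc0 : 0 ≤ c := by positivity
  have hfac (p : ℕ) : columnFactor a b p = ENNReal.ofReal (1 + c * (1 / √((p : ℝ) + 1))) := by
    rw [columnFactor, ENNReal.ofReal_add zero_le_one (by positivity), ENNReal.ofReal_one]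
    congr 1
    rw [← ENNReal.ofReal_toReal gaussianNegMoment_ne_top,
      ENNReal.ofReal_rpow_of_nonneg ENNReal.toReal_nonneg (by norm_num),
      ENNReal.ofReal_rpow_of_nonneg (by positivity) (by norm_num),
      ← ENNReal.ofReal_mul (by positivity), ← Real.sqrt_eq_rpow, ← Real.sqrt_eq_rpow]
    congr 1
    rw [hc, mul_assoc, mul_one_div, ← Real.sqrt_div (by positivity)]
    congr 2
    ring
  simp only [hfac]
  rw [← ENNReal.ofReal_prod_of_nonneg fun p _ => by positivity]
  refine ENNReal.ofReal_le_ofReal ?_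
  calc ∏ p ∈ range m, (1 + c * (1 / √((p : ℝ) + 1)))
      ≤ ∏ p ∈ range m, Real.exp (c * (1 / √((p : ℝ) + 1))) := by
        refine prod_le_prod (fun p _ => by positivity) fun p _ => ?_
        rw [add_comm]
        exact Real.add_one_le_exp _
    _ = Real.exp (c * ∑ p ∈ range m, 1 / √((p : ℝ) + 1)) := by
        rw [← Real.exp_sum, mul_sum]
    _ ≤ _ := Real.exp_le_exp.2 (mul_le_mul_of_nonneg_left (sum_inv_sqrt_le m) hc0)

lemma tendsto_exp_sqrt_sub {c δ : ℝ} (hδ : 0 < δ) :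
    Tendsto (fun n : ℕ => Real.exp (c * (2 * √n)) * Real.exp (-(n * δ / 8))) atTop (𝓝 0) := by
  simp only [← Real.exp_add]
  refine Real.tendsto_exp_atBot.comp ?_
  have hs : Tendsto (fun n : ℕ => √(n : ℝ)) atTop atTop :=
    Real.tendsto_sqrt_atTop.comp tendsto_natCast_atTop_atTop
  have h1 : Tendsto (fun n : ℕ => √(n : ℝ) * (2 * c - δ / 8 * √n)) atTop atBot := by
    refine hs.atTop_mul_atBot₀ ?_
    exact tendsto_atBot_add_const_left _ _
      (tendsto_neg_atTop_atBot.comp (hs.const_mul_atTop (by positivity : 0 < δ / 8)))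
  refine h1.congr fun n => ?_
  have : √(n : ℝ) * √n = n := Real.mul_self_sqrt (by positivity)
  linear_combination (-δ / 8) * this

end

end PermanentEstimator

end

theorem theorem2p1 {Ω : Type*} [MeasurableSpace Ω] (P : Measure Ω) [IsProbabilityMeasure P]
    (a b : ℝ) (ha : 0 < a) (hab : a ≤ b)
    (x : ℕ → ℕ → Ω → ℝ)
    (hlaw : ∀ i j, HasLaw (x i j) (gaussianReal 0 1) P)
    (hindep : iIndepFun (fun p : ℕ × ℕ => x p.1 p.2) P)
    (δ : ℝ) (hδ : 0 < δ) :
    Tendsto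
      (fun n : ℕ =>
        ⨆ (m : ℕ) (_ : m ≤ n) (A : Matrix (Fin n) (Fin m) ℝ) (_ : ∀ i j, A i j ∈ Set.Icc a b),
          P (PermanentEstimator.deviationEvent x A δ))
      atTop (𝓝 0) := by
  obtain ⟨c, hc, hprod⟩ := PermanentEstimator.exists_prod_columnFactor_le a b ha hab
  have hlim : Tendsto (fun n : ℕ => ENNReal.ofReal (Real.exp (-(n * δ))) +
      ENNReal.ofReal (Real.exp (c * (2 * √n)) * Real.exp (-(n * δ / 8)))) atTop (𝓝 0) := by
    have h1 : Tendsto (fun n : ℕ => Real.exp (-(n * δ))) atTop (𝓝 0) :=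
      Real.tendsto_exp_neg_atTop_nhds_zero.comp
        (tendsto_natCast_atTop_atTop.atTop_mul_const hδ)
    have h2 := PermanentEstimator.tendsto_exp_sqrt_sub (c := c) hδ
    simpa using (ENNReal.tendsto_ofReal h1).add (ENNReal.tendsto_ofReal h2)
  refine tendsto_of_tendsto_of_tendsto_of_le_of_le' tendsto_const_nhds hlim
    (Eventually.of_forall fun _ => zero_le) ?_
  filter_upwards [eventually_gt_atTop 0] with n hn
  refine iSup₂_le fun m hmn => iSup₂_le fun A hA => ?_
  refine (PermanentEstimator.measure_deviationEvent_le hlaw hindep ha hab hA hmn hn δ).trans ?_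
  gcongr
  rw [ENNReal.ofReal_mul (Real.exp_pos _).le]
  gcongr
  refine (hprod m).trans (ENNReal.ofReal_le_ofReal (Real.exp_le_exp.2 ?_))
  gcongr
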